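/- Let $X$ be a real Banach space and let $E\in C^1(X,\mathbb R)$. Let $\Phi$ be the set of all continuous maps $\Gamma: X\times[0,1]\to X$, written $\Gamma(u,t)=\Gamma(t)u$, such that: (i) $\Gamma(0)=\mathrm{id}$; (ii) $\Gamma(t)$ is a homeomorphism of $X$ for every $t\in[0,1)$, and $(u,t)\mapsto\Gamma(t)^{-1}u$ is continuous on $X\times[0,1)$; (iii) $\Gamma(1)X$ is a single point, and $\Gamma(t)u\to\Gamma(1)X$ as $t\to1$, uniformly on bounded subsets of $X$; (iv) for every bounded $S\subset X$ and $t_0\in[0,1)$, $\sup_{(u,t)\in S\times[0,t_0]}\big(\|\Gamma(t)u\|+\|\Gamma(t)^{-1}u\|\big)<\infty$. For disjoint nonempty sets $A,B\subset X$, say that $A$ links $B$ if $\Gamma(A\times(0,1])\cap B\neq\emptyset$ for all $\Gamma\in\Phi$. Let $A,B\subset X$ be disjoint nonempty sets such that $A$ links $B$, and assume that $B$ is a cone ($tu\in B$ for all $u\in B$ and $t\ge0$). Let $e\in X$ with $e\notin B$ and $-e\notin B$, let $Q=\{u+se: u\in B,\ s\ge0\}$, and assume $$\sup_{u\in B}E(u)<\inf_{u\in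 A}E(u),\qquad \sup_{u\in Q}E(u)<\infty.$$ Let $\widetilde H$ be the set of all homeomorphisms $h$ of $X$ onto itself such that $h$ and $h^{-1}$ map bounded sets into bounded sets and $h|_B=\mathrm{id}$. Then $$\inf_{u\in A}E(u)\le c:=\inf_{h\in\widetilde H}\ \sup_{u\in h(Q)}E(u)\le\sup_{u\in Q}E(u);$$ in particular, $c$ is a real number. Moreover, if $E$ satisfies the Palais–Smale condition at level $c$ (every sequence $(u_j)$ in $X$ with $E(u_j)\to c$ and $E'(u_j)\to0$ in $X^*$ has a convergent subsequence), then $c$ is a critical value of $E$, that is, there is $u\in X$ with $E'(u)=0$ and $E(u)=c$. -/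

import Mathlib

open Set Filter Topology

namespace Schechter

variable {X : Type*} [NormedAddCommGroup X] [NormedSpace ℝ X]

/-- `B` is a cone: `t u ∈ B` whenever `u ∈ B` and `t ≥ 0`. -/
def IsCone (B : Set X) : Prop :=
  ∀ u ∈ B, ∀ t : ℝ, 0 ≤ t → t • u ∈ B

/-- The class `Φ` of continuous contractions `Γ : X × [0,1] → X`, written `Γ t u`.
The map `Γinv` is the family of inverses `(u, t) ↦ Γ(t)⁻¹ u` on `X × [0,1)`; its values at `t = 1`
are irrelevant. That `Γ t` is a homeomorphism for `t < 1` is expressed by `Γinv t` being a two-sided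
inverse, together with the (joint) continuity of both maps. -/
def IsContraction (Γ : unitInterval → X → X) : Prop :=
  Continuous (fun p : X × unitInterval => Γ p.2 p.1) ∧
  (∀ u, Γ 0 u = u) ∧
  (∃ Γinv : unitInterval → X → X,
    (∀ t, t < 1 → Function.LeftInverse (Γinv t) (Γ t) ∧ Function.RightInverse (Γinv t) (Γ t)) ∧
    ContinuousOn (fun p : X × unitInterval => Γinv p.2 p.1) {p | p.2 < 1} ∧
    (∀ S : Set X, Bornology.IsBounded S → ∀ t₀ : unitInterval, t₀ < 1 →
      ∃ C : ℝ, ∀ u ∈ S, ∀ t ≤ t₀, ‖Γ t u‖ + ‖Γinv t u‖ ≤ C)) ∧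
  (∃ p : X, (∀ u, Γ 1 u = p) ∧
    ∀ S : Set X, Bornology.IsBounded S → TendstoUniformlyOn Γ (fun _ => p) (𝓝[<] 1) S)

/-- `A` links `B`: `Γ(A × (0,1])` meets `B` for every `Γ ∈ Φ`. -/
def Links (A B : Set X) : Prop :=
  ∀ Γ : unitInterval → X → X, IsContraction Γ →
    ∃ u ∈ A, ∃ t : unitInterval, 0 < t ∧ Γ t u ∈ B

/-- The class of homeomorphisms `h` of `X` onto itself such that `h` and `h⁻¹` map bounded sets
into bounded sets and `h` is the identity on `B`. -/
def homeosFixing (B : Set X) : Set (X ≃ₜ X) :=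
  {h | (∀ S : Set X, Bornology.IsBounded S → Bornology.IsBounded (h '' S)) ∧
       (∀ S : Set X, Bornology.IsBounded S → Bornology.IsBounded (h.symm '' S)) ∧
       ∀ u ∈ B, h u = u}

/-- The set `{u + s e : u ∈ B, s ≥ 0}`. -/
def halfCylinder (B : Set X) (e : X) : Set X :=
  {x | ∃ u ∈ B, ∃ s : ℝ, 0 ≤ s ∧ x = u + s • e}

/-- The minimax level `inf_{h} sup_{u ∈ h(Q)} E(u)`, over the homeomorphisms `h` fixing `B`,
as an extended real number. -/
noncomputable def minimaxLevel (E : X → ℝ) (B Q : Set X) : EReal :=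
  ⨅ h ∈ homeosFixing B, ⨆ u ∈ h '' Q, (E u : EReal)

/-- The Palais-Smale condition at level `c`: every sequence `u j` with `E (u j) → c` and
`E' (u j) → 0` in the dual space has a convergent subsequence. -/
def PalaisSmale (E : X → ℝ) (c : ℝ) : Prop :=
  ∀ u : ℕ → X, Tendsto (fun j => E (u j)) atTop (𝓝 c) →
    Tendsto (fun j => fderiv ℝ E (u j)) atTop (𝓝 0) →
    ∃ x : X, ∃ φ : ℕ → ℕ, StrictMono φ ∧ Tendsto (u ∘ φ) atTop (𝓝 x)

/-- `c` is a critical value of `E`. -/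
def IsCriticalValue (E : X → ℝ) (c : ℝ) : Prop :=
  ∃ u : X, fderiv ℝ E u = 0 ∧ E u = c

end Schechter

/-! Linking makes `A` meet `h(Q)` for every admissible `h`. The maps `Γ(t)u = h((1-t)h⁻¹u - te)`
belong to `Φ`, so some `Γ(t)u` with `u ∈ A` lies in `B`. As `h` fixes `B`, already `(1-t)h⁻¹u - te ∈
B`; `t = 1` is excluded by `-e ∉ B`, and dividing by `1-t` in the cone gives `h⁻¹u ∈ Q`. Hence
`inf_A E ≤ c`, so `sup_B E < c`; the identity gives the upper bound.

If `c` were not critical, Palais–Smale would keep `‖E'‖` away from zero near level `c`. The flow of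
a bounded locally Lipschitz descent field then pushes `{E ≤ c + ε}` into `{E ≤ c - ε}` and fixes `{E
≤ c - 2ε}`, which contains `B` for small `ε`. A bounded field has a global flow with bounded
displacement, so composing an almost optimal `h` with it stays in the class and contradicts the
definition of `c`. -/

namespace Schechter

/-! ### Global flows of bounded locally Lipschitz fields. -/

section Flow

variable {X : Type*} [NormedAddCommGroup X] [NormedSpace ℝ X]

/-- `γ` solves the autonomous equation `γ' = F(γ)` on `[0, T]`. -/
def IsSolution (F : X → X) (T : ℝ) (γ : ℝ → X) : Prop :=
  ∀ t ∈ Icc 0 T, HasDerivWithinAt γ (F (γ t)) (Icc 0 T) t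

namespace IsSolution

variable {F : X → X} {T S : ℝ} {γ η : ℝ → X}

theorem continuousOn (h : IsSolution F T γ) : ContinuousOn γ (Icc 0 T) :=
  fun t ht => (h t ht).continuousWithinAt

theorem mono (h : IsSolution F T γ) (hS : S ≤ T) : IsSolution F S γ := fun t ht =>
  (h t ⟨ht.1, ht.2.trans hS⟩).mono (Icc_subset_Icc_right hS)

theorem hasDerivWithinAt_Ici (h : IsSolution F T γ) {t : ℝ} (ht : t ∈ Ico 0 T) :
    HasDerivWithinAt γ (F (γ t)) (Ici t) t :=
  (h t ⟨ht.1, ht.2.le⟩).mono_of_mem_nhdsWithin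
    (mem_of_superset (Icc_mem_nhdsGE ht.2) (Icc_subset_Icc_left ht.1))

/-- The set of agreement is closed, and local uniqueness (Grönwall) extends it to the right of each
of its points. -/
theorem eqOn (hF : LocallyLipschitz F) (hγ : IsSolution F T γ) (hη : IsSolution F T η)
    (h0 : γ 0 = η 0) : EqOn γ η (Icc 0 T) := by
  refine IsClosed.Icc_subset_of_forall_mem_nhdsWithin (s := {t | γ t = η t}) ?_ h0 ?_
  · have : {t | γ t = η t} ∩ Icc 0 T = Icc 0 T ∩ (fun t => γ t - η t) ⁻¹' {0} := by
      ext t; simp [sub_eq_zero, and_comm]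
    rw [this]
    exact (hγ.continuousOn.sub hη.continuousOn).preimage_isClosed_of_isClosed isClosed_Icc
      isClosed_singleton
  · rintro t ⟨hte, ht⟩
    obtain ⟨K, U, hU, hK⟩ := hF (γ t)
    have ht' : t ∈ Icc 0 T := ⟨ht.1, ht.2.le⟩
    have hnhds : Icc 0 T ∈ 𝓝[≥] t :=
      mem_of_superset (Icc_mem_nhdsGE ht.2) (Icc_subset_Icc_left ht.1)
    have h1 : ∀ᶠ s in 𝓝[≥] t, γ s ∈ U ∧ η s ∈ U ∧ s ∈ Icc 0 T := by
      refine (Tendsto.eventually ?_ hU).and ((Tendsto.eventually ?_ hU).and hnhds)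
      · exact ((hγ t ht').continuousWithinAt.mono_of_mem_nhdsWithin hnhds)
      · have := ((hη t ht').continuousWithinAt.mono_of_mem_nhdsWithin hnhds)
        rw [ContinuousWithinAt, ← show γ t = η t from hte] at this
        exact this
    obtain ⟨b, hb, hbs⟩ := mem_nhdsGE_iff_exists_Icc_subset.1 h1
    have hbs' : ∀ s ∈ Icc t b, γ s ∈ U ∧ η s ∈ U ∧ s ∈ Icc 0 T := fun s hs => hbs hs
    have hsub : Icc t b ⊆ Icc 0 T := fun s hs => (hbs' s hs).2.2
    have hbT : b ≤ T := (hsub (right_mem_Icc.2 (le_of_lt hb))).2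
    have := ODE_solution_unique_of_mem_Icc_right (v := fun _ => F) (s := fun _ => U) (K := K)
      (fun _ _ => hK) (hγ.continuousOn.mono hsub)
      (fun s hs => hγ.hasDerivWithinAt_Ici ⟨ht.1.trans hs.1, hs.2.trans_le hbT⟩)
      (fun s hs => (hbs' s ⟨hs.1, hs.2.le⟩).1) (hη.continuousOn.mono hsub)
      (fun s hs => hη.hasDerivWithinAt_Ici ⟨ht.1.trans hs.1, hs.2.trans_le hbT⟩)
      (fun s hs => (hbs' s ⟨hs.1, hs.2.le⟩).2.1) hte
    exact mem_of_superset (Ioc_mem_nhdsGT hb) fun s hs => this ⟨hs.1.le, hs.2⟩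

theorem dist_le {M : ℝ} (hM : ∀ x, ‖F x‖ ≤ M) (h : IsSolution F T γ) {s t : ℝ}
    (hs : s ∈ Icc 0 T) (ht : t ∈ Icc 0 T) : ‖γ t - γ s‖ ≤ M * ‖t - s‖ :=
  (convex_Icc 0 T).norm_image_sub_le_of_norm_hasDerivWithin_le h (fun _ _ => hM _) hs ht

theorem reverse (h : IsSolution F T γ) :
    IsSolution (fun x => -F x) T (fun t => γ (T - t)) := fun t ht => by
  have ht' : T - t ∈ Icc 0 T := ⟨by linarith [ht.2], by linarith [ht.1]⟩
  have h1 : HasDerivWithinAt (fun t : ℝ => T - t) (-1) (Icc 0 T) t := by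
    simpa using (hasDerivWithinAt_id t (Icc 0 T)).const_sub T
  have := (h _ ht').scomp t h1 fun s hs => ⟨by linarith [hs.2], by linarith [hs.1]⟩
  simpa [Function.comp_def] using this

theorem glue (hγ : IsSolution F T γ) (hη : IsSolution F S η) (hT : 0 ≤ T) (hS : 0 ≤ S)
    (h0 : η 0 = γ T) : IsSolution F (T + S) (fun t => if t ≤ T then γ t else η (t - T)) := by
  set ζ : ℝ → X := fun t => if t ≤ T then γ t else η (t - T) with hζ
  have e1 : EqOn ζ γ (Icc 0 T) := fun t ht => by simp [hζ, ht.2]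
  have e2 : EqOn ζ (fun t => η (t - T)) (Icc T (T + S)) := fun t ht => by
    rcases ht.1.eq_or_lt with rfl | h
    · simp [hζ, h0]
    · simp [hζ, h.not_ge]
  intro t ht
  rw [← Icc_union_Icc_eq_Icc hT (by linarith : T ≤ T + S)]
  refine HasDerivWithinAt.union ?_ ?_
  · by_cases h : t ≤ T
    · have h' : t ∈ Icc 0 T := ⟨ht.1, h⟩
      rw [e1 h']
      exact (hγ t h').congr e1 (e1 h')
    · refine HasFDerivWithinAt.of_notMem_closure ?_
      rw [isClosed_Icc.closure_eq]
      exact fun h' => h h'.2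
  · by_cases h : T ≤ t
    · have h' : t ∈ Icc T (T + S) := ⟨h, ht.2⟩
      rw [e2 h']
      refine HasDerivWithinAt.congr ?_ e2 (e2 h')
      have h1 : HasDerivWithinAt (fun t : ℝ => t - T) 1 (Icc T (T + S)) t := by
        simpa using (hasDerivWithinAt_id t (Icc T (T + S))).sub_const T
      have hmaps : MapsTo (fun t => t - T) (Icc T (T + S)) (Icc 0 S) :=
        fun s hs => ⟨by linarith [hs.1], by linarith [hs.2]⟩
      have := (hη (t - T) (hmaps h')).scomp t h1 hmaps
      simpa [Function.comp_def] using this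
    · refine HasFDerivWithinAt.of_notMem_closure ?_
      rw [isClosed_Icc.closure_eq]
      exact fun h' => h h'.1

end IsSolution

/-- Local flow of a locally Lipschitz vector field, with a time of existence that is uniform in a
neighbourhood. -/
theorem exists_local_flow [CompleteSpace X] {F : X → X} (hF : LocallyLipschitz F) {M : ℝ}
    (hM : ∀ x, ‖F x‖ ≤ M) (p : X) :
    ∃ r > (0 : ℝ), ∃ ε > (0 : ℝ), ∃ α : X → ℝ → X,
      (∀ x ∈ Metric.closedBall p r, α x 0 = x ∧ IsSolution F ε (α x)) ∧
      ∀ t ∈ Icc 0 ε, ContinuousOn (fun x => α x t) (Metric.closedBall p r) := by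
  obtain ⟨K, U, hU, hK⟩ := hF p
  obtain ⟨a, ha, haU⟩ := Metric.nhds_basis_closedBall.mem_iff.1 hU
  have hM0 : 0 ≤ M := (norm_nonneg _).trans (hM p)
  -- At speed at most `M`, a path from the ball of radius `a/2` stays in the ball of radius `a` for
  -- this long; `M + 1` avoids division by zero.
  set ε : ℝ := a / 2 / (M + 1) with hε
  have hεpos : 0 < ε := by positivity
  have hpl : IsPicardLindelof (fun _ => F) (tmin := 0) (tmax := ε) ⟨0, le_rfl, hεpos.le⟩ p
      ⟨a, ha.le⟩ ⟨a / 2, by positivity⟩ ⟨M, hM0⟩ K := by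
    refine IsPicardLindelof.of_time_independent (fun x _ => hM x) (hK.mono haU) ?_
    have : M * ε ≤ a / 2 := by
      rw [hε, mul_div_assoc', div_le_iff₀ (by positivity)]
      nlinarith
    change M * max (ε - 0) (0 - 0) ≤ a - a / 2
    rw [sub_zero, sub_zero, max_eq_left hεpos.le]
    linarith
  obtain ⟨α, hα, L, hL⟩ := hpl.exists_forall_mem_closedBall_eq_hasDerivWithinAt_lipschitzOnWith
  exact ⟨a / 2, by positivity, ε, hεpos, α, hα, fun t ht => (hL t ht).continuousOn⟩

/-- The flow to time `T` is defined near `x₀` and continuous at `x₀`. -/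
def FlowsTo (F : X → X) (x₀ : X) (T : ℝ) : Prop :=
  ∃ φ : X → X, ContinuousAt φ x₀ ∧
    ∀ᶠ x in 𝓝 x₀, ∃ γ, γ 0 = x ∧ IsSolution F T γ ∧ γ T = φ x

theorem flowsTo_zero (F : X → X) (x₀ : X) : FlowsTo F x₀ 0 := by
  refine ⟨id, continuousAt_id, Eventually.of_forall fun x => ⟨fun _ => x, rfl, fun t ht => ?_, rfl⟩⟩
  rw [Icc_self] at ht ⊢
  rw [mem_singleton_iff.1 ht]
  exact HasFDerivWithinAt.singleton

/-- Continuation: bounded speed makes endpoints converge as the time tends to the supremum of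
attainable times. The local flow around the limit, with its uniform lifespan, then carries the
solutions on, continuity at `x₀` included. -/
theorem flowsTo [CompleteSpace X] {F : X → X} (hF : LocallyLipschitz F) {M : ℝ}
    (hM : ∀ x, ‖F x‖ ≤ M) (x₀ : X) {T : ℝ} (hT : 0 ≤ T) : FlowsTo F x₀ T := by
  set S : Set ℝ := {t | t ∈ Icc 0 T ∧ FlowsTo F x₀ t} with hS
  have hM0 : 0 ≤ M := (norm_nonneg _).trans (hM x₀)
  have h0 : (0 : ℝ) ∈ S := ⟨⟨le_rfl, hT⟩, flowsTo_zero F x₀⟩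
  have hbdd : BddAbove S := ⟨T, fun t ht => ht.1.2⟩
  have hsol : ∀ t : ℝ, t ∈ S → ∃ γ : ℝ → X, γ 0 = x₀ ∧ IsSolution F t γ := fun t ht => by
    obtain ⟨φ, -, hφ⟩ := ht.2
    obtain ⟨γ, h1, h2, -⟩ := hφ.self_of_nhds
    exact ⟨γ, h1, h2⟩
  choose! γ hγ0 hγ using hsol
  have hend : ∀ s ∈ S, ∀ t ∈ S, s ≤ t → ‖γ t t - γ s s‖ ≤ M * ‖t - s‖ := by
    intro s hs t ht hst
    have h1 := IsSolution.eqOn hF (hγ s hs) ((hγ t ht).mono hst)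
      ((hγ0 s hs).trans (hγ0 t ht).symm) (right_mem_Icc.2 hs.1.1)
    rw [h1]
    exact (hγ t ht).dist_le hM ⟨hs.1.1, hst⟩ (right_mem_Icc.2 ht.1.1)
  have hLip : LipschitzOnWith ⟨M, hM0⟩ (fun t => γ t t) S := by
    refine LipschitzOnWith.of_dist_le_mul fun s hs t ht => ?_
    rcases le_total s t with h | h
    · rw [dist_comm, dist_comm s, dist_eq_norm, dist_eq_norm]
      exact hend s hs t ht h
    · rw [dist_eq_norm, dist_eq_norm]
      exact hend t ht s hs h
  obtain ⟨u, -, hu, huS⟩ := exists_seq_tendsto_sSup ⟨0, h0⟩ hbdd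
  obtain ⟨p, hp⟩ := cauchySeq_tendsto_of_complete
    (hLip.cauchySeq_comp hu.cauchySeq (range_subset_iff.2 huS))
  obtain ⟨r, hr, ε, hε, α, hα, hαc⟩ := exists_local_flow hF hM p
  obtain ⟨n, hn1, hn2⟩ := ((hp.eventually (Metric.ball_mem_nhds p hr)).and
    (hu.eventually (Ioi_mem_nhds (show sSup S - ε < sSup S by linarith)))).exists
  set t := u n with ht
  have htS : t ∈ S := huS n
  obtain ⟨φ, hφc, hφ⟩ := htS.2
  have hφx : φ x₀ = γ t t := by
    obtain ⟨η, h1, h2, h3⟩ := hφ.self_of_nhds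
    rw [← h3]
    exact IsSolution.eqOn hF h2 (hγ t htS) (h1.trans (hγ0 t htS).symm) (right_mem_Icc.2 htS.1.1)
  have hball : Metric.ball p r ∈ 𝓝 (φ x₀) := Metric.isOpen_ball.mem_nhds (hφx ▸ hn1)
  have hstep : t + min ε (T - t) ∈ S := by
    set s := min ε (T - t) with hs
    have hs0 : 0 ≤ s := le_min hε.le (by linarith [htS.1.2])
    have hsε : s ≤ ε := min_le_left _ _
    refine ⟨⟨by linarith [htS.1.1], by linarith [min_le_right ε (T - t)]⟩,
      fun x => α (φ x) s, ?_, ?_⟩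
    · have : ContinuousAt (fun x => α x s) (φ x₀) :=
        (hαc s ⟨hs0, hsε⟩).continuousAt (mem_of_superset hball Metric.ball_subset_closedBall)
      exact ContinuousAt.comp (g := fun x => α x s) this hφc
    · filter_upwards [hφ, hφc.eventually hball] with x hx hxb
      obtain ⟨η, h1, h2, h3⟩ := hx
      obtain ⟨h4, h5⟩ := hα (φ x) (Metric.ball_subset_closedBall hxb)
      refine ⟨_, ?_, h2.glue (h5.mono hsε) htS.1.1 hs0 (h4.trans h3.symm), ?_⟩
      · simpa [htS.1.1] using h1
      · rcases hs0.eq_or_lt with h | h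
        · simp [← h, h4, h3]
        · simp [h.not_ge]
  -- Since `t > sSup S - ε`, a full step `ε` would pass the supremum; so the step ends at `T`.
  rcases min_cases ε (T - t) with ⟨h, -⟩ | ⟨h, -⟩
  · rw [h] at hstep
    have h6 := le_csSup hbdd hstep
    have h7 : sSup S - ε < t := hn2
    linarith
  · rw [h, add_sub_cancel] at hstep
    exact hstep.2

/-- The time-`T` map of a bounded locally Lipschitz vector field is a homeomorphism. -/
theorem exists_flow_homeomorph [CompleteSpace X] {F : X → X} (hF : LocallyLipschitz F) {M : ℝ}
    (hM : ∀ x, ‖F x‖ ≤ M) {T : ℝ} (hT : 0 ≤ T) :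
    ∃ σ : X ≃ₜ X, ∀ x, ∃ γ, γ 0 = x ∧ IsSolution F T γ ∧ γ T = σ x := by
  have key : ∀ G : X → X, LocallyLipschitz G → (∀ x, ‖G x‖ ≤ M) →
      ∃ φ : X → X, Continuous φ ∧ ∀ x, ∃ γ, γ 0 = x ∧ IsSolution G T γ ∧ γ T = φ x := by
    intro G hG hGM
    have hsol : ∀ x : X, ∃ γ : ℝ → X, γ 0 = x ∧ IsSolution G T γ := fun x => by
      obtain ⟨φ, -, hφ⟩ := flowsTo hG hGM x hT
      obtain ⟨γ, h1, h2, -⟩ := hφ.self_of_nhds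
      exact ⟨γ, h1, h2⟩
    choose γ hγ0 hγ using hsol
    refine ⟨fun x => γ x T, continuous_iff_continuousAt.2 fun x => ?_,
      fun x => ⟨γ x, hγ0 x, hγ x, rfl⟩⟩
    obtain ⟨φ, hφc, hφ⟩ := flowsTo hG hGM x hT
    refine hφc.congr ?_
    filter_upwards [hφ] with y hy
    obtain ⟨η, h1, h2, h3⟩ := hy
    rw [← h3]
    exact IsSolution.eqOn hG h2 (hγ y) (h1.trans (hγ0 y).symm) (right_mem_Icc.2 hT)
  have hF' : LocallyLipschitz fun x => -F x := fun x => by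
    obtain ⟨K, U, hU, hK⟩ := hF x
    exact ⟨K, U, hU, hK.neg⟩
  obtain ⟨φ, hφc, hφ⟩ := key F hF hM
  obtain ⟨ψ, hψc, hψ⟩ := key _ hF' fun x => by simpa using hM x
  have inv : ∀ (G : X → X), LocallyLipschitz (fun x => -G x) → ∀ f g : X → X,
      (∀ x, ∃ γ, γ 0 = x ∧ IsSolution G T γ ∧ γ T = f x) →
      (∀ x, ∃ γ, γ 0 = x ∧ IsSolution (fun x => -G x) T γ ∧ γ T = g x) → ∀ x, g (f x) = x := by
    intro G hG f g hf hg x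
    obtain ⟨γ, h1, h2, h3⟩ := hf x
    obtain ⟨η, h4, h5, h6⟩ := hg (f x)
    have := IsSolution.eqOn hG h5 h2.reverse (by simp [h4, h3]) (right_mem_Icc.2 hT)
    simpa [h6, h1] using this
  refine ⟨⟨⟨φ, ψ, inv F hF' φ ψ hφ hψ, inv (fun x => -F x) (by simpa using hF) ψ φ hψ
    (by simpa using hφ)⟩, hφc, hψc⟩, hφ⟩

end Flow

/-! ### Locally Lipschitz selections. -/

/-- Locally constant selections of a convex-valued map glue to a locally Lipschitz selection. -/
theorem exists_locallyLipschitz_forall_mem_convex_of_local_const {Y V : Type*} [MetricSpace Y]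
    [NormedAddCommGroup V] [NormedSpace ℝ V] {t : Y → Set V} (ht : ∀ y, Convex ℝ (t y))
    (H : ∀ y, ∃ c, ∀ᶠ z in 𝓝 y, c ∈ t z) :
    ∃ F : Y → V, LocallyLipschitz F ∧ ∀ y, F y ∈ t y := by
  classical
  choose v hv using H
  obtain ⟨U, hUo, hUc, hUf, hUs⟩ := precise_refinement (fun y => interior {z | v y ∈ t z})
    (fun _ => isOpen_interior)
    (iUnion_eq_univ_iff.2 fun y => ⟨y, mem_interior_iff_mem_nhds.2 (hv y)⟩)
  -- Unnormalised partition of unity. The case `U i = univ` is separate because `infDist` to the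
  -- empty set is `0`.
  set g : Y → Y → ℝ := fun i y => if U i = univ then 1 else Metric.infDist y (U i)ᶜ with hg
  have gLip : ∀ i, LipschitzWith 1 (g i) := fun i => by
    by_cases h : U i = univ
    · simpa [hg, h] using (LipschitzWith.const (α := Y) (1 : ℝ)).weaken (zero_le_one (α := NNReal))
    · simpa [hg, h] using Metric.lipschitz_infDist_pt (U i)ᶜ
  have g0 : ∀ i y, 0 ≤ g i y := fun i y => by
    by_cases h : U i = univ <;> simp [hg, h, Metric.infDist_nonneg]
  have gU : ∀ i y, g i y ≠ 0 → y ∈ U i := fun i y h => by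
    by_contra hy
    have h' : U i ≠ univ := fun h => hy (h ▸ mem_univ y)
    exact h (by simp only [hg, h', if_false]; exact Metric.infDist_zero_of_mem hy)
  have gpos : ∀ i y, y ∈ U i → 0 < g i y := fun i y hy => by
    by_cases h : U i = univ
    · simp [hg, h]
    · have := ((hUo i).isClosed_compl.notMem_iff_infDist_pos
        (nonempty_compl.2 h) (x := y)).1 (by simpa using hy)
      simpa only [hg, h, if_false] using this
  set G : Y → ℝ := fun y => ∑ᶠ i, g i y with hG
  have gfin : ∀ y, (Function.support fun i => g i y).Finite := fun y =>
    (hUf.point_finite y).subset fun i hi => gU i y hi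
  have Gpos : ∀ y, 0 < G y := fun y => by
    obtain ⟨i, hi⟩ := mem_iUnion.1 (hUc ▸ mem_univ y)
    exact finsum_pos (fun j => g0 j y) ⟨i, gpos i y hi⟩ (gfin y)
  refine ⟨fun y => ∑ᶠ i, (g i y / G y) • v i, fun y => ?_, fun y => ?_⟩
  · obtain ⟨N, hN, hNf⟩ := hUf y
    set I : Finset Y := hNf.toFinset
    have hI : ∀ z ∈ N, ∀ i, g i z ≠ 0 → i ∈ I := fun z hz i hi =>
      hNf.mem_toFinset.2 ⟨z, gU i z hi, hz⟩
    have hGI : ∀ z ∈ N, G z = ∑ i : I, g i z := fun z hz => by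
      rw [Finset.sum_coe_sort I fun i => g i z]
      exact finsum_eq_sum_of_support_subset _ fun i hi => hI z hz i hi
    -- Near `y` the average is a function of finitely many 1-Lipschitz weights, `C¹` where their sum
    -- is nonzero.
    set Ψ : (I → ℝ) → V := fun w => (∑ i, w i)⁻¹ • ∑ i, w i • v i
    set W : Y → I → ℝ := fun z i => g i z
    have hW : LipschitzWith 1 W := LipschitzWith.of_dist_le_mul fun a b => by
      refine (dist_pi_le_iff (by positivity)).2 fun i => ?_
      exact (gLip i).dist_le_mul a b
    have hΨ : ContDiffAt ℝ 1 Ψ (W y) := by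
      refine ContDiffAt.smul (ContDiffAt.inv ?_ ?_) ?_
      · exact ContDiffAt.sum fun i _ => by fun_prop
      · exact (hGI y (mem_of_mem_nhds hN) ▸ Gpos y).ne'
      · exact ContDiffAt.sum fun i _ => by fun_prop
    obtain ⟨K, s, hs, hK⟩ := hΨ.exists_lipschitzOnWith
    refine ⟨K * 1, N ∩ W ⁻¹' s, inter_mem hN (hW.continuous.continuousAt hs), ?_⟩
    have hcomp : LipschitzOnWith (K * 1) (Ψ ∘ W) (N ∩ W ⁻¹' s) :=
      hK.comp hW.lipschitzOnWith fun z hz => hz.2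
    have heq : EqOn (fun y => ∑ᶠ i, (g i y / G y) • v i) (Ψ ∘ W) (N ∩ W ⁻¹' s) := by
      intro z hz
      have h1 : ∑ᶠ i, (g i z / G z) • v i = ∑ i ∈ I, (g i z / G z) • v i :=
        finsum_eq_sum_of_support_subset _ fun i hi => hI z hz.1 i fun h => hi (by simp [h])
      change ∑ᶠ i, (g i z / G z) • v i = (∑ i : I, g i z)⁻¹ • ∑ i : I, g i z • v i
      rw [h1, ← hGI z hz.1, Finset.smul_sum, ← Finset.sum_coe_sort]
      exact Finset.sum_congr rfl fun i _ => by rw [smul_smul, div_eq_inv_mul]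
    intro a ha b hb
    rw [heq ha, heq hb]
    exact hcomp ha hb
  · refine (ht y).finsum_mem (fun i => div_nonneg (g0 i y) (Gpos y).le) ?_ fun i hi => ?_
    · simp_rw [div_eq_mul_inv]
      rw [← finsum_mul' _ _ (gfin y)]
      exact mul_inv_cancel₀ (Gpos y).ne'
    · have hy : g i y ≠ 0 := fun h => hi (by simp [h])
      have hmem : y ∈ {z | v i ∈ t z} := interior_subset (hUs i (gU i y hy))
      exact hmem

/-! ### Deformation below a noncritical level. -/

section Deformation

variable {X : Type*} [NormedAddCommGroup X] [NormedSpace ℝ X]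

theorem exists_norm_le_one_apply_lt_neg {f : X →L[ℝ] ℝ} {δ : ℝ} (hδ : 0 ≤ δ) (h : δ < ‖f‖) :
    ∃ v : X, ‖v‖ ≤ 1 ∧ f v < -δ := by
  by_contra! hc
  refine h.not_ge (f.opNorm_le_of_unit_norm hδ fun x hx => ?_)
  have h1 := hc x hx.le
  have h2 := hc (-x) (by rw [norm_neg, hx])
  rw [map_neg] at h2
  rw [Real.norm_eq_abs, abs_le]
  exact ⟨h1, by linarith⟩

/-- A bounded locally Lipschitz descent field for `E`, vanishing below the level `c - 2ε` and
uniformly decreasing `E` in the band `|E - c| ≤ ε`. -/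
theorem exists_descent_field {E : X → ℝ} (hE : ContDiff ℝ 1 E) {c ε δ : ℝ} (hε : 0 < ε)
    (hδ : 0 < δ) (h : ∀ u, |E u - c| ≤ ε → δ < ‖fderiv ℝ E u‖) :
    ∃ F : X → X, LocallyLipschitz F ∧ (∀ u, ‖F u‖ ≤ 1) ∧ (∀ u, fderiv ℝ E u (F u) ≤ 0) ∧
      (∀ u, |E u - c| ≤ ε → fderiv ℝ E u (F u) ≤ -δ) ∧ ∀ u, E u ≤ c - 2 * ε → F u = 0 := by
  have hd : Continuous (fderiv ℝ E) := hE.continuous_fderiv one_ne_zero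
  have hc : Continuous E := hE.continuous
  suffices ∃ F : X → X, LocallyLipschitz F ∧ ∀ u, F u ∈ {v : X | ‖v‖ ≤ 1 ∧
      fderiv ℝ E u v ≤ 0 ∧ (|E u - c| ≤ ε → fderiv ℝ E u v ≤ -δ) ∧ (E u ≤ c - 2 * ε → v = 0)} by
    obtain ⟨F, hF, hFm⟩ := this
    exact ⟨F, hF, fun u => (hFm u).1, fun u => (hFm u).2.1, fun u => (hFm u).2.2.1,
      fun u => (hFm u).2.2.2⟩
  refine exists_locallyLipschitz_forall_mem_convex_of_local_const (fun u => ?_) (fun u => ?_)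
  · rintro x ⟨hx1, hx2, hx3, hx4⟩ y ⟨hy1, hy2, hy3, hy4⟩ a b ha hb hab
    refine ⟨?_, ?_, fun hu => ?_, fun hu => by simp [hx4 hu, hy4 hu]⟩
    · have := convex_closedBall (0 : X) 1 (mem_closedBall_zero_iff.2 hx1)
        (mem_closedBall_zero_iff.2 hy1) ha hb hab
      exact mem_closedBall_zero_iff.1 this
    · simp only [map_add, map_smul, smul_eq_mul]
      nlinarith
    · simp only [map_add, map_smul, smul_eq_mul]
      have h1 := mul_le_mul_of_nonneg_left (hx3 hu) ha
      have h2 := mul_le_mul_of_nonneg_left (hy3 hu) hb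
      have h3 : a * -δ + b * -δ = -δ := by rw [← add_mul, hab, one_mul]
      linarith
  · by_cases hu : |E u - c| ≤ ε
    · obtain ⟨v, hv1, hv2⟩ := exists_norm_le_one_apply_lt_neg hδ.le (h u hu)
      refine ⟨v, ?_⟩
      have h1 : ∀ᶠ z in 𝓝 u, fderiv ℝ E z v < -δ :=
        ((hd.clm_apply continuous_const).tendsto u).eventually (Iio_mem_nhds hv2)
      have h2 : ∀ᶠ z in 𝓝 u, c - 2 * ε < E z :=
        (hc.tendsto u).eventually (Ioi_mem_nhds (by linarith [(abs_le.1 hu).1]))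
      filter_upwards [h1, h2] with z hz1 hz2
      exact ⟨hv1, by linarith, fun _ => hz1.le, fun hz => absurd hz hz2.not_ge⟩
    -- Off the closed band the zero vector meets every constraint, and it keeps doing so nearby.
    · refine ⟨0, ?_⟩
      have h1 : ∀ᶠ z in 𝓝 u, ε < |E z - c| :=
        ((hc.sub continuous_const).abs.tendsto u).eventually (Ioi_mem_nhds (not_le.1 hu))
      filter_upwards [h1] with z hz
      exact ⟨by simp, by simp, fun h => absurd h hz.not_ge, fun _ => rfl⟩

/-- Deformation lemma with uniformly bounded displacement. -/
theorem exists_deformation [CompleteSpace X] {E : X → ℝ} (hE : ContDiff ℝ 1 E) {c ε δ : ℝ}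
    (hε : 0 < ε) (hδ : 0 < δ) (h : ∀ u, |E u - c| ≤ ε → δ < ‖fderiv ℝ E u‖) :
    ∃ σ : X ≃ₜ X, (∃ M, ∀ u, ‖σ u - u‖ ≤ M) ∧ (∀ u, E u ≤ c - 2 * ε → σ u = u) ∧
      ∀ u, E u ≤ c + ε → E (σ u) ≤ c - ε := by
  obtain ⟨F, hF, hF1, hF0, hFδ, hFz⟩ := exists_descent_field hE hε hδ h
  -- Time needed to descend by `2ε` at rate `δ`.
  set T : ℝ := 2 * ε / δ with hT
  have hT0 : 0 ≤ T := by positivity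
  obtain ⟨σ, hσ⟩ := exists_flow_homeomorph hF hF1 hT0
  refine ⟨σ, ⟨T, fun u => ?_⟩, fun u hu => ?_, fun u hu => ?_⟩
  · obtain ⟨γ, h1, h2, h3⟩ := hσ u
    have := h2.dist_le hF1 (left_mem_Icc.2 hT0) (right_mem_Icc.2 hT0)
    simpa [h1, h3, abs_of_nonneg hT0] using this
  · obtain ⟨γ, h1, h2, h3⟩ := hσ u
    have hconst : IsSolution F T fun _ => u := fun t _ => by
      rw [hFz u hu]
      exact hasDerivWithinAt_const _ _ _
    rw [← h3]
    exact IsSolution.eqOn hF h2 hconst h1 (right_mem_Icc.2 hT0)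
  · obtain ⟨γ, h1, h2, h3⟩ := hσ u
    -- If the endpoint were above `c - ε`, monotonicity would keep the whole path in the band, where
    -- `E` falls at rate `δ`: a total drop of `2ε`.
    by_contra! hlt
    have hder : ∀ t ∈ Icc 0 T, HasDerivWithinAt (fun t => E (γ t))
        (fderiv ℝ E (γ t) (F (γ t))) (Icc 0 T) t := fun t ht =>
      ((hE.differentiable one_ne_zero _).hasFDerivAt).comp_hasDerivWithinAt t (h2 t ht)
    have hanti : AntitoneOn (fun t => E (γ t)) (Icc 0 T) :=
      antitoneOn_of_hasDerivWithinAt_nonpos (convex_Icc 0 T)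
        (fun t ht => (hder t ht).continuousWithinAt)
        (fun t ht => (hder t (interior_subset ht)).mono interior_subset) fun t _ => hF0 _
    have hband : ∀ t ∈ Icc 0 T, |E (γ t) - c| ≤ ε := fun t ht => by
      have h4 := hanti (left_mem_Icc.2 hT0) ht ht.1
      have h5 := hanti ht (right_mem_Icc.2 hT0) ht.2
      simp only [h1, h3] at h4 h5
      rw [abs_le]
      constructor <;> linarith
    have hder' : ∀ t ∈ Icc 0 T, HasDerivWithinAt (fun t => E (γ t) + δ * t)
        (fderiv ℝ E (γ t) (F (γ t)) + δ) (Icc 0 T) t := fun t ht => by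
      have h4 : HasDerivWithinAt (fun t => δ * t) δ (Icc 0 T) t := by
        simpa using (hasDerivWithinAt_id t (Icc 0 T)).const_mul δ
      exact (hder t ht).add h4
    have hanti' : AntitoneOn (fun t => E (γ t) + δ * t) (Icc 0 T) :=
      antitoneOn_of_hasDerivWithinAt_nonpos (convex_Icc 0 T)
        (fun t ht => (hder' t ht).continuousWithinAt)
        (fun t ht => (hder' t (interior_subset ht)).mono interior_subset) fun t ht => by
          linarith [hFδ (γ t) (hband t (interior_subset ht))]
    have := hanti' (left_mem_Icc.2 hT0) (right_mem_Icc.2 hT0) hT0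
    simp only [h1, h3, mul_zero, add_zero] at this
    have h6 : δ * T = 2 * ε := by rw [hT]; field_simp
    linarith

/-- If `c` is not a critical value and the Palais–Smale condition holds at level `c`, the
derivative is bounded away from zero near that level. -/
theorem PalaisSmale.exists_lt_norm_fderiv {E : X → ℝ} (hE : ContDiff ℝ 1 E) {c : ℝ}
    (hPS : PalaisSmale E c) (hc : ¬ IsCriticalValue E c) :
    ∃ δ > 0, ∀ u, |E u - c| ≤ δ → δ < ‖fderiv ℝ E u‖ := by
  by_contra! hcon
  choose u hu1 hu2 using fun n : ℕ => hcon (1 / ((n : ℝ) + 1)) (by positivity)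
  have hlim := tendsto_one_div_add_atTop_nhds_zero_nat (𝕜 := ℝ)
  have h1 : Tendsto (fun n => E (u n)) atTop (𝓝 c) :=
    tendsto_iff_norm_sub_tendsto_zero.2 (squeeze_zero (fun _ => norm_nonneg _) hu1 hlim)
  have h2 : Tendsto (fun n => fderiv ℝ E (u n)) atTop (𝓝 0) :=
    squeeze_zero_norm hu2 hlim
  obtain ⟨x, φ, hφ, hx⟩ := hPS u h1 h2
  refine hc ⟨x, ?_, ?_⟩
  · exact tendsto_nhds_unique (((hE.continuous_fderiv one_ne_zero).tendsto x).comp hx)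
      (h2.comp hφ.tendsto_atTop)
  · exact tendsto_nhds_unique ((hE.continuous.tendsto x).comp hx) (h1.comp hφ.tendsto_atTop)

end Deformation

/-! ### Linking and intersection. -/

section Linking

variable {X : Type*} [NormedAddCommGroup X] [NormedSpace ℝ X]

/-- Conjugating the straight-line contraction to `-e` by a homeomorphism that is bounded in both
directions yields a member of the class `Φ`. -/
theorem isContraction_conj (h : X ≃ₜ X)
    (hb : ∀ S : Set X, Bornology.IsBounded S → Bornology.IsBounded (h '' S))
    (hb' : ∀ S : Set X, Bornology.IsBounded S → Bornology.IsBounded (h.symm '' S)) (e : X) :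
    IsContraction fun t u => h ((1 - (t : ℝ)) • h.symm u - (t : ℝ) • e) := by
  have hlt : ∀ t : unitInterval, t < 1 → (0 : ℝ) < 1 - t := fun t ht =>
    sub_pos.2 (by exact_mod_cast ht)
  have hcs : Continuous h.symm := h.symm.continuous
  refine ⟨by fun_prop, fun u => by simp,
    ⟨fun t u => h ((1 - (t : ℝ))⁻¹ • (h.symm u + (t : ℝ) • e)), fun t ht => ⟨fun u => ?_,
      fun u => ?_⟩, ?_, fun S hS t₀ ht₀ => ?_⟩, h (-e), fun u => by simp, fun S hS => ?_⟩
  · simp [smul_smul, inv_mul_cancel₀ (hlt t ht).ne']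
  · simp [smul_smul, ← mul_assoc, mul_inv_cancel₀ (hlt t ht).ne']
  · refine h.continuous.comp_continuousOn (ContinuousOn.smul (ContinuousOn.inv₀ ?_ ?_) ?_)
    · fun_prop
    · exact fun p hp => (hlt p.2 hp).ne'
    · fun_prop
  · obtain ⟨R, hR⟩ := (hb' S hS).exists_norm_le
    have hpos := hlt t₀ ht₀
    -- One radius bounding the arguments of `h` in both `Γ` and its inverse, for all `t ≤ t₀`.
    set R' : ℝ := (1 - (t₀ : ℝ))⁻¹ * (R + ‖e‖) with hR'
    obtain ⟨C, hC⟩ := (hb _ (Metric.isBounded_closedBall (x := (0 : X)) (r := R'))).exists_norm_le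
    refine ⟨C + C, fun u hu t ht => ?_⟩
    have hw : ‖h.symm u‖ ≤ R := hR _ (mem_image_of_mem _ hu)
    have hR0 : 0 ≤ R := (norm_nonneg _).trans hw
    have ht1 : (t : ℝ) ≤ t₀ := by exact_mod_cast ht
    have ht0 : (0 : ℝ) ≤ t := t.2.1
    have hnt : ‖(t : ℝ) • e‖ ≤ ‖e‖ := by
      rw [norm_smul, Real.norm_of_nonneg ht0]
      exact mul_le_of_le_one_left (norm_nonneg _) t.2.2
    have h1 : 1 ≤ (1 - (t₀ : ℝ))⁻¹ := (one_le_inv₀ hpos).2 (by linarith [t₀.2.1])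
    refine add_le_add (hC _ (mem_image_of_mem _ ?_)) (hC _ (mem_image_of_mem _ ?_)) <;>
      rw [mem_closedBall_zero_iff]
    · have h2 : ‖(1 - (t : ℝ)) • h.symm u‖ ≤ R := by
        rw [norm_smul, Real.norm_of_nonneg (by linarith)]
        exact (mul_le_of_le_one_left (norm_nonneg _) (by linarith)).trans hw
      calc _ ≤ R + ‖e‖ := (norm_sub_le _ _).trans (add_le_add h2 hnt)
        _ ≤ R' := le_mul_of_one_le_left (by positivity) h1
    · have h3 : (1 - (t : ℝ))⁻¹ ≤ (1 - (t₀ : ℝ))⁻¹ := inv_anti₀ hpos (by linarith)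
      rw [norm_smul, Real.norm_of_nonneg (inv_nonneg.2 (by linarith))]
      exact mul_le_mul h3 ((norm_add_le _ _).trans (add_le_add hw hnt)) (norm_nonneg _)
        (by positivity)
  · obtain ⟨R, hR⟩ := (hb' S hS).exists_norm_le
    rw [Metric.tendstoUniformlyOn_iff]
    intro ε hε
    obtain ⟨δ, hδ, hδε⟩ := Metric.continuousAt_iff.1 (h.continuous.continuousAt (x := -e)) ε hε
    have hlim : Tendsto (fun t : unitInterval => (1 - (t : ℝ)) * (R + ‖e‖)) (𝓝[<] 1) (𝓝 0) := by
      have : Continuous fun t : unitInterval => (1 - (t : ℝ)) * (R + ‖e‖) := by fun_prop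
      simpa using (this.tendsto 1).mono_left nhdsWithin_le_nhds
    filter_upwards [hlim.eventually (Iio_mem_nhds hδ)] with t ht u hu
    rw [dist_comm]
    refine hδε (lt_of_le_of_lt ?_ ht)
    have h1 : (1 - (t : ℝ)) • h.symm u - (t : ℝ) • e - -e = (1 - (t : ℝ)) • (h.symm u + e) := by
      module
    have h2 : (0 : ℝ) ≤ 1 - t := sub_nonneg.2 t.2.2
    rw [dist_eq_norm, h1, norm_smul, Real.norm_of_nonneg h2]
    exact mul_le_mul_of_nonneg_left
      ((norm_add_le _ _).trans (add_le_add_left (hR _ (mem_image_of_mem _ hu)) _)) h2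

/-- If `A` links the cone `B` and `-e ∉ B`, then `A` meets the image of `B + ℝ≥0 e` under every
homeomorphism in the class fixing `B`. -/
theorem Links.inter_image_halfCylinder_nonempty {A B : Set X} (hlink : Links A B)
    (hcone : IsCone B) {e : X} (hne : -e ∉ B) {h : X ≃ₜ X} (hh : h ∈ homeosFixing B) :
    (A ∩ h '' halfCylinder B e).Nonempty := by
  obtain ⟨hb, hb', hfix⟩ := hh
  obtain ⟨u, hu, t, -, htB⟩ := hlink _ (isContraction_conj h hb hb' e)
  -- A point whose image lies in `B` equals that image, since `h` fixes the image and is injective.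
  have hy : (1 - (t : ℝ)) • h.symm u - (t : ℝ) • e ∈ B := by
    rwa [h.injective (hfix _ htB)] at htB
  rcases t.2.2.eq_or_lt with ht | ht
  · exact absurd (by simpa [ht] using hy) hne
  · have hpos : (0 : ℝ) < 1 - t := sub_pos.2 ht
    refine ⟨u, hu, h.symm u, ⟨_, hcone _ hy (1 - (t : ℝ))⁻¹ (inv_nonneg.2 hpos.le),
      (1 - (t : ℝ))⁻¹ * t, mul_nonneg (inv_nonneg.2 hpos.le) t.2.1, ?_⟩, h.apply_symm_apply u⟩
    rw [smul_sub, smul_smul, smul_smul, inv_mul_cancel₀ hpos.ne', one_smul, sub_add_cancel]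

end Linking

/-! ### The admissible class and the minimax level. -/

section Class

variable {X : Type*} [NormedAddCommGroup X]

theorem refl_mem_homeosFixing (B : Set X) : Homeomorph.refl X ∈ homeosFixing B :=
  ⟨fun S hS => by simpa using hS, fun S hS => by simpa using hS, fun _ _ => rfl⟩

theorem trans_mem_homeosFixing {B : Set X} {h k : X ≃ₜ X} (hh : h ∈ homeosFixing B)
    (hk : k ∈ homeosFixing B) : h.trans k ∈ homeosFixing B := by
  refine ⟨fun S hS => ?_, fun S hS => ?_, fun u hu => ?_⟩
  · have := hk.1 _ (hh.1 S hS)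
    rwa [image_image] at this
  · have := hh.2.1 _ (hk.2.1 S hS)
    rwa [image_image] at this
  · rw [Homeomorph.trans_apply, hh.2.2 u hu, hk.2.2 u hu]

theorem mem_homeosFixing_of_norm_sub_le {B : Set X} {σ : X ≃ₜ X} {M : ℝ}
    (hM : ∀ u, ‖σ u - u‖ ≤ M) (hB : ∀ u ∈ B, σ u = u) : σ ∈ homeosFixing B := by
  have key : ∀ f : X → X, (∀ u, ‖f u - u‖ ≤ M) → ∀ S : Set X, Bornology.IsBounded S →
      Bornology.IsBounded (f '' S) := fun f hf S hS => by
    obtain ⟨R, hR⟩ := hS.exists_norm_le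
    refine isBounded_iff_forall_norm_le.2 ⟨M + R, ?_⟩
    rintro _ ⟨u, hu, rfl⟩
    calc ‖f u‖ = ‖(f u - u) + u‖ := by rw [sub_add_cancel]
      _ ≤ M + R := (norm_add_le _ _).trans (add_le_add (hf u) (hR u hu))
  refine ⟨key σ hM, key σ.symm fun u => ?_, hB⟩
  have := hM (σ.symm u)
  rwa [σ.apply_symm_apply, norm_sub_rev] at this

theorem le_minimaxLevel {E : X → ℝ} {A B Q : Set X}
    (h : ∀ k ∈ homeosFixing B, (A ∩ k '' Q).Nonempty) :
    (⨅ u ∈ A, (E u : EReal)) ≤ minimaxLevel E B Q := by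
  refine le_iInf₂ fun k hk => ?_
  obtain ⟨x, hxA, hxQ⟩ := h k hk
  exact (iInf₂_le x hxA).trans (le_iSup₂ (f := fun u (_ : u ∈ k '' Q) => (E u : EReal)) x hxQ)

theorem minimaxLevel_le (E : X → ℝ) (B Q : Set X) :
    minimaxLevel E B Q ≤ ⨆ u ∈ Q, (E u : EReal) := by
  have := iInf₂_le (f := fun h (_ : h ∈ homeosFixing B) => ⨆ u ∈ h '' Q, (E u : EReal))
    (Homeomorph.refl X) (refl_mem_homeosFixing B)
  simpa [minimaxLevel] using this

end Class

theorem isCriticalValue_of_minimaxLevel {X : Type*} [NormedAddCommGroup X] [NormedSpace ℝ X]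
    [CompleteSpace X] {E : X → ℝ} (hE : ContDiff ℝ 1 E) {B Q : Set X} {c : ℝ}
    (hc : (c : EReal) = minimaxLevel E B Q) (hB : (⨆ u ∈ B, (E u : EReal)) < c)
    (hPS : PalaisSmale E c) : IsCriticalValue E c := by
  by_contra hcrit
  obtain ⟨δ, hδ, hδE⟩ := hPS.exists_lt_norm_fderiv hE hcrit
  obtain ⟨b, hb, hbc⟩ := EReal.lt_iff_exists_real_btwn.1 hB
  have hbc : b < c := EReal.coe_lt_coe_iff.1 hbc
  -- The first bound keeps the band where `‖E'‖ > δ`; the second gives `b ≤ c - 2ε`, so the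
  -- deformation fixes `B`.
  set ε := min δ ((c - b) / 2) with hε
  have hε0 : 0 < ε := lt_min hδ (by linarith)
  obtain ⟨σ, ⟨M, hM⟩, hσ, hdef⟩ := exists_deformation hE hε0 hδ
    fun u hu => hδE u (hu.trans (min_le_left _ _))
  have hσB : σ ∈ homeosFixing B := mem_homeosFixing_of_norm_sub_le hM fun u hu => hσ u <| by
    have h1 : (E u : EReal) < b :=
      (le_iSup₂ (f := fun u (_ : u ∈ B) => (E u : EReal)) u hu).trans_lt hb
    have h2 : E u < b := EReal.coe_lt_coe_iff.1 h1
    have h3 : ε ≤ (c - b) / 2 := min_le_right _ _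
    linarith
  have hlt : minimaxLevel E B Q < ((c + ε : ℝ) : EReal) := by
    rw [← hc]
    exact EReal.coe_lt_coe_iff.2 (by linarith)
  obtain ⟨h, hlt⟩ := iInf_lt_iff.1 hlt
  obtain ⟨hh, hlt⟩ := iInf_lt_iff.1 hlt
  have hle : minimaxLevel E B Q ≤ ((c - ε : ℝ) : EReal) := by
    refine (iInf₂_le (h.trans σ) (trans_mem_homeosFixing hh hσB)).trans (iSup₂_le ?_)
    rintro _ ⟨x, hx, rfl⟩
    have h1 : (E (h x) : EReal) < ((c + ε : ℝ) : EReal) :=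
      (le_iSup₂ (f := fun u (_ : u ∈ h '' Q) => (E u : EReal)) _
        (mem_image_of_mem h hx)).trans_lt hlt
    exact EReal.coe_le_coe_iff.2 (hdef _ (EReal.coe_lt_coe_iff.1 h1).le)
  rw [← hc, EReal.coe_le_coe_iff] at hle
  linarith

end Schechter

theorem theorem6 {X : Type*} [NormedAddCommGroup X] [NormedSpace ℝ X] [CompleteSpace X]
    (E : X → ℝ) (hE : ContDiff ℝ 1 E)
    (A B : Set X) (hAB : Disjoint A B) (hA : A.Nonempty) (hB : B.Nonempty)
    (hlink : Schechter.Links A B) (hcone : Schechter.IsCone B)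
    (e : X) (he : e ∉ B) (hne : -e ∉ B)
    (hlt : (⨆ u ∈ B, (E u : EReal)) < ⨅ u ∈ A, (E u : EReal))
    (hQ : (⨆ u ∈ Schechter.halfCylinder B e, (E u : EReal)) < ⊤) :
    ∃ c : ℝ,
      (c : EReal) = Schechter.minimaxLevel E B (Schechter.halfCylinder B e) ∧
      (⨅ u ∈ A, (E u : EReal)) ≤ (c : EReal) ∧
      (c : EReal) ≤ (⨆ u ∈ Schechter.halfCylinder B e, (E u : EReal)) ∧
      (Schechter.PalaisSmale E c → Schechter.IsCriticalValue E c) := by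
  have hlow := Schechter.le_minimaxLevel (E := E) fun _ hk =>
    hlink.inter_image_halfCylinder_nonempty hcone hne hk
  have hup := Schechter.minimaxLevel_le E B (Schechter.halfCylinder B e)
  have hbot : Schechter.minimaxLevel E B (Schechter.halfCylinder B e) ≠ ⊥ :=
    (bot_le.trans_lt (hlt.trans_le hlow)).ne'
  have hc := EReal.coe_toReal (hup.trans_lt hQ).ne hbot
  exact ⟨_, hc, hlow.trans hc.ge, hc.le.trans hup, fun hPS =>
    Schechter.isCriticalValue_of_minimaxLevel hE hc (hlt.trans_le (hlow.trans hc.ge)) hPS⟩
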